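/- Let $K$ be a field, let $1<m\le n$ and let $\lambda=(\lambda_1,\dots,\lambda_m)$ be a partition with $n=\lambda_1\ge\lambda_2\ge\cdots\ge\lambda_m\ge m$. Let $R=K[x_1,\dots,x_n]$ with the standard grading, and let $$I=(x_ix_j \;:\; 1\le i\le m,\ i\le j\le\lambda_i)\subset R$$ be the strongly stable ideal generated in degree two associated with $\lambda$; that is, $I$ is the image under the specialization $x_i\mapsto x_i,\ y_j\mapsto x_j$ of the generalized Ferrers ideal $I_{\lambda-\mu}=(x_iy_j : \mu_i<j\le\lambda_i)\subset K[x_1,\dots,x_m,y_1,\dots,y_n]$ with $\mu=(0,1,\dots,m-1)$. Let $m_I$ be the least common multiple of the minimal monomial generators $f_1,\dots,f_\nu$ of $I$, and let $\widehat I=(m_I/f_1,\dots,m_I/f_\nu)$ be the LCM-dual of $I$. Let $\beta_{ij}$ be the graded Betti numbers of $R/\widehat I$, i.e. the number of basis elements of degree $j$ in the $i$-th module of a minimal graded free resolution of $R/\widehat I$ over $R$. Put $\operatorname{pd}(R/\widehat I)=\max\{i:\beta_{ij}\ne0\text{ for some }j\}$ and $\operatorname{reg}(R/\widehat I)=\max\{j-i:\beta_{ij}\neq0\}$.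 Then a minimal graded free resolution of $R/\widehat I$ exists, and for every such resolution the following hold: 1. $\operatorname{reg}(R/\widehat I)=\deg(m_I)-3=\lambda_1+m-3=n+m-3$. 2. $\operatorname{pd}(R/\widehat I)=3$ if $\lambda_2\ge3$ (in particular whenever $m\ge3$); in the remaining case $m=\lambda_2=2$ one has $\operatorname{pd}(R/\widehat I)=2$. 3. $R/\widehat I$ has a linear free resolution: for every $i\ge1$, $\beta_{ij}\ne0$ only if $j=(n+m-2)+(i-1)$. -/

import Mathlib

open MvPolynomial

noncomputable section

/-! ### LCM-duals of monomial ideals -/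

/-- Exponent vectors of the minimal monomial generators of a monomial ideal `J`: the monomials of
`J` which are minimal for divisibility (the order on exponent vectors is coordinatewise). -/
def minGens {σ K : Type*} [Field K] (J : Ideal (MvPolynomial σ K)) : Set (σ →₀ ℕ) :=
  {a | Minimal (fun b : σ →₀ ℕ => monomial b (1 : K) ∈ J) a}

theorem minGens_finite {σ K : Type*} [Finite σ] [Field K] (J : Ideal (MvPolynomial σ K)) :
    (minGens J).Finite :=
  WellQuasiOrderedLE.finite_of_isAntichain (setOfPred_minimal_antichain _)

/-- The exponent vector of `m_J`, the least common multiple of the minimal monomial generators. -/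
def lcmExponent {σ K : Type*} [Finite σ] [Field K] (J : Ideal (MvPolynomial σ K)) : σ →₀ ℕ :=
  (minGens_finite J).toFinset.sup id

/-- Every minimal generator divides the lcm, so the subtraction in `lcmDual` is a true one. -/
theorem le_lcmExponent {σ K : Type*} [Finite σ] [Field K] (J : Ideal (MvPolynomial σ K))
    {a : σ →₀ ℕ} (ha : a ∈ minGens J) : a ≤ lcmExponent J :=
  Finset.le_sup (f := id) ((minGens_finite J).mem_toFinset.2 ha)

/-- The LCM-dual of a monomial ideal `J`: generated by the monomials `m_J / f`, for `f` running
through the minimal monomial generators of `J`. -/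
def lcmDual {σ K : Type*} [Finite σ] [Field K] (J : Ideal (MvPolynomial σ K)) :
    Ideal (MvPolynomial σ K) :=
  Ideal.span ((fun a => monomial (lcmExponent J - a) (1 : K)) '' minGens J)

/-! ### Generalized Ferrers ideals and their specializations -/

/-- The generalized Ferrers ideal `I_{λ-μ}` in `K[x_1, …, x_m, y_1, …, y_n]`, generated by the
`x_i y_j` with `μ_i < j ≤ λ_i`. The index `j : Fin n` stands for the number `j + 1`. -/
def generalizedFerrersIdeal (K : Type*) [Field K] {m : ℕ} (n : ℕ) (lam mu : Fin m → ℕ) :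
    Ideal (MvPolynomial (Fin m ⊕ Fin n) K) :=
  Ideal.span {p | ∃ (i : Fin m) (j : Fin n), mu i < (j : ℕ) + 1 ∧ (j : ℕ) + 1 ≤ lam i ∧
    p = X (Sum.inl i) * X (Sum.inr j)}

/-- The specialization homomorphism `x_i ↦ x_i`, `y_j ↦ x_j`. -/
def specializationMap (K : Type*) [Field K] {m n : ℕ} (hmn : m ≤ n) :
    MvPolynomial (Fin m ⊕ Fin n) K →ₐ[K] MvPolynomial (Fin n) K :=
  rename (Sum.elim (Fin.castLE hmn) id)

/-- The ideal of `K[x_1, …, x_n]` obtained from `I_{λ-μ}`, `μ = (0, 1, …, m-1)`, by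
specialization. -/
def stronglyStableIdeal (K : Type*) [Field K] {m n : ℕ} (hmn : m ≤ n) (lam : Fin m → ℕ) :
    Ideal (MvPolynomial (Fin n) K) :=
  (generalizedFerrersIdeal K n lam (fun i => (i : ℕ))).map (specializationMap K hmn)

/-! ### Minimal graded free resolutions -/

/-- The standard grading of `R / J`, `R = K[x_1, …, x_n]`: the images of the homogeneous forms. -/
def quotientGrading {K : Type*} [Field K] {n : ℕ} (J : Ideal (MvPolynomial (Fin n) K)) (j : ℕ) :
    AddSubgroup (MvPolynomial (Fin n) K ⧸ J) :=
  (homogeneousSubmodule (Fin n) K j).toAddSubgroup.map (Ideal.Quotient.mk J).toAddMonoidHom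

/-- A minimal graded free resolution `⋯ → F₂ → F₁ → F₀ → M → 0` of a module `M` over
`K[x_1, …, x_n]` with a grading `𝓜` by the natural numbers. The module `F i` has a finite basis
whose `a`-th element has degree `deg i a`. -/
structure MinimalGradedFreeResolution (K : Type*) [Field K] (n : ℕ) {M : Type*} [AddCommGroup M]
    [Module (MvPolynomial (Fin n) K) M] (𝓜 : ℕ → AddSubgroup M) where
  rank : ℕ → ℕ
  deg : (i : ℕ) → Fin (rank i) → ℕ
  d : (i : ℕ) → (Fin (rank (i + 1)) → MvPolynomial (Fin n) K) →ₗ[MvPolynomial (Fin n) K]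
    (Fin (rank i) → MvPolynomial (Fin n) K)
  ε : (Fin (rank 0) → MvPolynomial (Fin n) K) →ₗ[MvPolynomial (Fin n) K] M
  /-- The differentials are homogeneous of degree zero. -/
  d_homogeneous : ∀ (i : ℕ) (a : Fin (rank i)) (b : Fin (rank (i + 1))),
    d i (Pi.single b 1) a = 0 ∨
      ∃ e : ℕ, deg (i + 1) b = deg i a + e ∧ (d i (Pi.single b 1) a).IsHomogeneous e
  /-- The augmentation is homogeneous of degree zero. -/
  ε_homogeneous : ∀ a : Fin (rank 0), ε (Pi.single a 1) ∈ 𝓜 (deg 0 a)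
  ε_surjective : Function.Surjective ε
  exact_zero : Function.Exact (d 0) ε
  exact_succ : ∀ i : ℕ, Function.Exact (d (i + 1)) (d i)
  /-- Minimality: the image of each differential lies in `(x_1, …, x_n) F`. -/
  minimal : ∀ (i : ℕ) (v : Fin (rank (i + 1)) → MvPolynomial (Fin n) K) (a : Fin (rank i)),
    constantCoeff (d i v a) = 0

namespace MinimalGradedFreeResolution

variable {K : Type*} [Field K] {n : ℕ} {M : Type*} [AddCommGroup M]
  [Module (MvPolynomial (Fin n) K) M] {𝓜 : ℕ → AddSubgroup M}

/-- The graded Betti number `β_{ij}`: the number of basis elements of degree `j` of `F i`. -/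
def betti (F : MinimalGradedFreeResolution K n 𝓜) (i j : ℕ) : ℕ :=
  (Finset.univ.filter fun a : Fin (F.rank i) => F.deg i a = j).card

/-- `p` is the projective dimension, `max {i : β_{ij} ≠ 0 for some j}`. -/
def IsProjectiveDimension (F : MinimalGradedFreeResolution K n 𝓜) (p : ℕ) : Prop :=
  IsGreatest {i : ℕ | ∃ j, F.betti i j ≠ 0} p

/-- `r` is the Castelnuovo-Mumford regularity, `max {j - i : β_{ij} ≠ 0}`. -/
def IsRegularity (F : MinimalGradedFreeResolution K n 𝓜) (r : ℤ) : Prop :=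
  IsGreatest {s : ℤ | ∃ i j : ℕ, F.betti i j ≠ 0 ∧ s = (j : ℤ) - (i : ℤ)} r

/-- For a resolution of `R / J`: it is linear, with `J` generated in degree `t`, if for every
`i ≥ 1` the free module in homological degree `i` is a sum of copies of `R(-(t + i - 1))`. -/
def IsLinear (F : MinimalGradedFreeResolution K n 𝓜) (t : ℕ) : Prop :=
  ∀ i j : ℕ, F.betti (i + 1) j ≠ 0 → j = t + i

end MinimalGradedFreeResolution

end

/-! ### Comparison of minimal graded free resolutions -/

section Comparison

variable {K : Type*} [Field K] {n : ℕ}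

/-! Write b for the first index and a for the exponent of m_I. The dual generators are x^a/f, with f
running over x_b x_j (the full first row), x_i² (diagonal boxes) and x_i x_j (boxes off the
diagonal, outside the first row). Multiplying x^a/(x_i x_j) by x_j gives x^a/x_i, which is also x_b
· x^a/(x_b x_i). So every generator is tied to the first row by linear syzygies: one for each
first-row box other than x_b², one for each diagonal box, two for each off-diagonal box. The two
belonging to the same off-diagonal box satisfy one linear relation modulo the first row, and these
relations are independent. This gives a complex 0 → R^off → R^Syz → R^Box → R with linear entries
after the first map. Exactness is checked by hand, clearing the off-diagonal and diagonal
coordinates before those of the first row.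

All four numerical claims can be read off the explicit resolution: it is linear, its generators have
degree deg m_I - 2 = n + m - 2, and its last module is nonzero exactly when an off-diagonal box
exists, that is, when λ_2 ≥ 3.

To pass to an arbitrary minimal resolution, comparison maps are built in both directions. Their
composites are homotopic to the identity, hence by minimality equal to it modulo (x_1, …, x_n).
Regularity, projective dimension and linearity depend only on which β_{ij} vanish, so it suffices to
match the sets of basis degrees, not their multiplicities. -/

/-- A vector is homogeneous of degree `D` in the free module whose basis has degrees `deg`. -/
def IsHomogeneousVec {ι : Type*} (deg : ι → ℕ) (D : ℕ) (v : ι → MvPolynomial (Fin n) K) : Prop :=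
  ∀ b, v b = 0 ∨ ∃ e : ℕ, D = deg b + e ∧ (v b).IsHomogeneous e

/-- The homogeneous component of degree `D` in the free module whose basis has degrees `deg`. -/
noncomputable def componentVec {ι : Type*} (deg : ι → ℕ) (D : ℕ)
    (v : ι → MvPolynomial (Fin n) K) : ι → MvPolynomial (Fin n) K :=
  fun b => if deg b ≤ D then homogeneousComponent (D - deg b) (v b) else 0

theorem isHomogeneousVec_componentVec {ι : Type*} (deg : ι → ℕ) (D : ℕ)
    (v : ι → MvPolynomial (Fin n) K) : IsHomogeneousVec deg D (componentVec deg D v) := by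
  intro b
  by_cases h : deg b ≤ D
  · right
    refine ⟨D - deg b, by omega, ?_⟩
    simp only [componentVec, if_pos h]
    exact homogeneousComponent_isHomogeneous _ _
  · left
    simp [componentVec, h]

theorem homogeneousComponent_mul_of_isHomogeneous {p q : MvPolynomial (Fin n) K} {e : ℕ}
    (hq : q.IsHomogeneous e) (k : ℕ) :
    homogeneousComponent k (p * q) = if e ≤ k then homogeneousComponent (k - e) p * q else 0 := by
  let : GradedAlgebra (homogeneousSubmodule (Fin n) K) := MvPolynomial.gradedAlgebra
  have key : ∀ (r : MvPolynomial (Fin n) K) (l : ℕ),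
      (DirectSum.decompose (homogeneousSubmodule (Fin n) K) r l : MvPolynomial (Fin n) K) =
        homogeneousComponent l r := decomposition.decompose'_apply
  have h := DirectSum.coe_decompose_mul_of_right_mem (homogeneousSubmodule (Fin n) K) k
    (a := p) (b := q) (i := e) hq
  simpa only [key] using h

theorem componentVec_of_isHomogeneousVec {ι : Type*} {deg : ι → ℕ} {D : ℕ}
    {v : ι → MvPolynomial (Fin n) K} (hv : IsHomogeneousVec deg D v) :
    componentVec deg D v = v := by
  funext b
  rcases hv b with h | ⟨e, he, h⟩
  · simp [componentVec, h]
  · have h1 : D - deg b = e := by omega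
    have h2 : deg b ≤ D := by omega
    simp only [componentVec, if_pos h2, h1]
    exact homogeneousComponent_eq_self h

theorem map_apply_eq_sum {R ι κ : Type*} [CommSemiring R] [Fintype ι] [DecidableEq ι]
    (d : (ι → R) →ₗ[R] (κ → R)) (v : ι → R) (a : κ) :
    d v a = ∑ b, v b * d (Pi.single b 1) a := by
  have h := LinearMap.pi_apply_eq_sum_univ d v
  conv_lhs => rw [h]
  simp only [Finset.sum_apply, Pi.smul_apply, smul_eq_mul]
  refine Finset.sum_congr rfl fun b _ => ?_
  refine congrArg (fun w => v b * d w a) (funext fun j => ?_)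
  simp [Pi.single_apply, eq_comm]

/-- A degree-zero map commutes with projection to a homogeneous component; projecting any preimage
of a homogeneous vector therefore yields a homogeneous preimage. -/
theorem map_componentVec {ι κ : Type*} [Fintype ι] [DecidableEq ι] {deg : ι → ℕ} {deg' : κ → ℕ}
    (d : (ι → MvPolynomial (Fin n) K) →ₗ[MvPolynomial (Fin n) K] (κ → MvPolynomial (Fin n) K))
    (hd : ∀ b, IsHomogeneousVec deg' (deg b) (d (Pi.single b 1))) (D : ℕ)
    (v : ι → MvPolynomial (Fin n) K) :
    d (componentVec deg D v) = componentVec deg' D (d v) := by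
  funext a
  rw [map_apply_eq_sum d]
  by_cases ha : deg' a ≤ D
  · simp only [componentVec, if_pos ha]
    rw [map_apply_eq_sum d v, map_sum]
    refine Finset.sum_congr rfl fun b _ => ?_
    rcases hd b a with h | ⟨e, he, h⟩
    · simp [h]
    · rw [homogeneousComponent_mul_of_isHomogeneous h]
      by_cases hb : deg b ≤ D
      · have h1 : e ≤ D - deg' a := by omega
        have h2 : D - deg' a - e = D - deg b := by omega
        rw [if_pos hb, if_pos h1, h2]
      · have h1 : ¬ e ≤ D - deg' a := by omega
        rw [if_neg hb, if_neg h1, zero_mul]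
  · simp only [componentVec, if_neg ha]
    refine Finset.sum_eq_zero fun b _ => ?_
    rcases hd b a with h | ⟨e, he, h⟩
    · simp [h]
    · have hb : ¬ deg b ≤ D := by omega
      rw [if_neg hb, zero_mul]

theorem exists_isHomogeneousVec_map_eq {ι κ : Type*} [Fintype ι] [DecidableEq ι] {deg : ι → ℕ}
    {deg' : κ → ℕ}
    (d : (ι → MvPolynomial (Fin n) K) →ₗ[MvPolynomial (Fin n) K] (κ → MvPolynomial (Fin n) K))
    (hd : ∀ b, IsHomogeneousVec deg' (deg b) (d (Pi.single b 1))) {D : ℕ}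
    {v : ι → MvPolynomial (Fin n) K} (hv : IsHomogeneousVec deg' D (d v)) :
    ∃ u, d u = d v ∧ IsHomogeneousVec deg D u :=
  ⟨componentVec deg D v, (map_componentVec d hd D v).trans (componentVec_of_isHomogeneousVec hv),
    isHomogeneousVec_componentVec deg D v⟩

theorem IsHomogeneousVec.map {ι κ : Type*} [Fintype ι] [DecidableEq ι] {deg : ι → ℕ}
    {deg' : κ → ℕ}
    {d : (ι → MvPolynomial (Fin n) K) →ₗ[MvPolynomial (Fin n) K] (κ → MvPolynomial (Fin n) K)}
    (hd : ∀ b, IsHomogeneousVec deg' (deg b) (d (Pi.single b 1))) {D : ℕ}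
    {v : ι → MvPolynomial (Fin n) K} (hv : IsHomogeneousVec deg D v) :
    IsHomogeneousVec deg' D (d v) := by
  rw [← componentVec_of_isHomogeneousVec hv, map_componentVec d hd]
  exact isHomogeneousVec_componentVec _ _ _

/-! ### Lifting maps out of free modules -/

theorem exists_lift_on_basis {R ι N N' : Type*} [CommSemiring R] [Fintype ι] [DecidableEq ι]
    [AddCommMonoid N] [Module R N] [AddCommMonoid N'] [Module R N'] (f : N' →ₗ[R] N)
    (g : (ι → R) →ₗ[R] N) (Q : ι → N' → Prop)
    (H : ∀ a, ∃ u, f u = g (Pi.single a 1) ∧ Q a u) :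
    ∃ h : (ι → R) →ₗ[R] N', (∀ v, f (h v) = g v) ∧ ∀ a, Q a (h (Pi.single a 1)) := by
  choose u hu hQ using H
  have key : ∀ a, Fintype.linearCombination R u (Pi.single a 1) = u a := fun a => by
    simp [Fintype.linearCombination_apply_single]
  refine ⟨Fintype.linearCombination R u, fun v => ?_, fun a => by rw [key]; exact hQ a⟩
  have : f ∘ₗ Fintype.linearCombination R u = g := by
    apply LinearMap.pi_ext'
    intro a
    ext
    simp [key, hu]
  exact LinearMap.congr_fun this v

theorem exists_lift {R ι N N' : Type*} [CommSemiring R] [Fintype ι] [DecidableEq ι]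
    [AddCommMonoid N] [Module R N] [AddCommMonoid N'] [Module R N'] (f : N' →ₗ[R] N)
    (g : (ι → R) →ₗ[R] N) (H : ∀ v, ∃ u, f u = g v) :
    ∃ h : (ι → R) →ₗ[R] N', ∀ v, f (h v) = g v := by
  obtain ⟨h, hh, -⟩ := exists_lift_on_basis f g (fun _ _ => True) fun a =>
    (H (Pi.single a 1)).imp fun u hu => ⟨hu, trivial⟩
  exact ⟨h, hh⟩

theorem constantCoeff_map_eq_zero {ι κ : Type*} [Fintype ι] [DecidableEq ι]
    (h : (ι → MvPolynomial (Fin n) K) →ₗ[MvPolynomial (Fin n) K] (κ → MvPolynomial (Fin n) K))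
    {v : ι → MvPolynomial (Fin n) K} (hv : ∀ a, constantCoeff (v a) = 0) (b : κ) :
    constantCoeff (h v b) = 0 := by
  rw [map_apply_eq_sum, map_sum]
  exact Finset.sum_eq_zero fun a _ => by rw [map_mul, hv, zero_mul]

/-! ### Homotopy comparison of two minimal resolutions -/

namespace MinimalGradedFreeResolution

variable {M : Type*} [AddCommGroup M] [Module (MvPolynomial (Fin n) K) M]
  {𝓜 : ℕ → AddSubgroup M}

theorem betti_ne_zero_iff (F : MinimalGradedFreeResolution K n 𝓜) (i j : ℕ) :
    F.betti i j ≠ 0 ↔ ∃ a, F.deg i a = j := by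
  simp [betti, Finset.filter_eq_empty_iff]

/-- The cycles of `F i`: the kernel of the map leaving `F i`. -/
def IsCycle (F : MinimalGradedFreeResolution K n 𝓜) :
    (i : ℕ) → (Fin (F.rank i) → MvPolynomial (Fin n) K) → Prop
  | 0, x => F.ε x = 0
  | i + 1, x => F.d i x = 0

theorem isCycle_iff (F : MinimalGradedFreeResolution K n 𝓜) (i : ℕ)
    (x : Fin (F.rank i) → MvPolynomial (Fin n) K) :
    F.IsCycle i x ↔ ∃ y, F.d i y = x := by
  cases i with
  | zero => exact F.exact_zero x
  | succ i => exact F.exact_succ i x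

/-- `ρ` is homotopic to the identity at position `i`: on cycles and up to `(x_1, …, x_n) F`. -/
def IsHomotopicIdAt (F : MinimalGradedFreeResolution K n 𝓜) (i : ℕ)
    (ρ : (Fin (F.rank i) → MvPolynomial (Fin n) K) →ₗ[MvPolynomial (Fin n) K]
      (Fin (F.rank i) → MvPolynomial (Fin n) K)) : Prop :=
  (∃ h : (Fin (F.rank i) → MvPolynomial (Fin n) K) →ₗ[MvPolynomial (Fin n) K]
      (Fin (F.rank (i + 1)) → MvPolynomial (Fin n) K),
      ∀ x, F.IsCycle i x → F.d i (h x) = ρ x - x) ∧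
    ∀ x a, constantCoeff (ρ x a) = constantCoeff (x a)

theorem isHomotopicIdAt_zero (F : MinimalGradedFreeResolution K n 𝓜)
    (ρ : (Fin (F.rank 0) → MvPolynomial (Fin n) K) →ₗ[MvPolynomial (Fin n) K]
      (Fin (F.rank 0) → MvPolynomial (Fin n) K)) (hρ : ∀ x, F.ε (ρ x) = F.ε x) :
    F.IsHomotopicIdAt 0 ρ := by
  obtain ⟨h, hh⟩ := exists_lift (F.d 0) (ρ - LinearMap.id) fun v =>
    (F.exact_zero _).1 (by simp [hρ])
  refine ⟨⟨h, fun x _ => hh x⟩, fun x a => ?_⟩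
  have h1 := F.minimal 0 (h x) a
  rw [hh] at h1
  simpa [sub_eq_zero] using h1

/-- The map ρ' - id - h ∘ d takes values in cycles, because d h = ρ - id on boundaries, so it lifts
to some h'. Then ρ' = id + h d + d h', and both correction terms vanish modulo the variables by
minimality. Asking for the homotopy only on cycles removes the term h d at the next stage and lets
position 0 be treated in the same way. -/
theorem IsHomotopicIdAt.succ {F : MinimalGradedFreeResolution K n 𝓜} {i : ℕ}
    {ρ : (Fin (F.rank i) → MvPolynomial (Fin n) K) →ₗ[MvPolynomial (Fin n) K]
      (Fin (F.rank i) → MvPolynomial (Fin n) K)} (hρ : F.IsHomotopicIdAt i ρ)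
    {ρ' : (Fin (F.rank (i + 1)) → MvPolynomial (Fin n) K) →ₗ[MvPolynomial (Fin n) K]
      (Fin (F.rank (i + 1)) → MvPolynomial (Fin n) K)}
    (hρ' : ∀ x, F.d i (ρ' x) = ρ (F.d i x)) : F.IsHomotopicIdAt (i + 1) ρ' := by
  obtain ⟨⟨h, hh⟩, -⟩ := hρ
  obtain ⟨h', hh'⟩ := exists_lift (F.d (i + 1)) (ρ' - LinearMap.id - h ∘ₗ F.d i) fun v =>
    (F.exact_succ i _).1 (by
      simp only [LinearMap.sub_apply, LinearMap.id_apply, LinearMap.comp_apply, map_sub, hρ']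
      rw [hh _ ((F.isCycle_iff i _).2 ⟨v, rfl⟩)]
      abel)
  refine ⟨⟨h', fun x hx => ?_⟩, fun x a => ?_⟩
  · rw [hh']
    have hx' : F.d i x = 0 := hx
    simp [hx']
  · have h1 := F.minimal (i + 1) (h' x) a
    rw [hh'] at h1
    have h2 := constantCoeff_map_eq_zero h (F.minimal i x) a
    simp only [LinearMap.sub_apply, LinearMap.id_apply, LinearMap.comp_apply, Pi.sub_apply,
      map_sub, h2, sub_zero] at h1
    exact sub_eq_zero.1 h1

/-- Preserving cycles is what allows the next pair of maps to be lifted through the differentials.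
Only `φ` is made homogeneous; this is enough for comparing degrees in both directions. -/
theorem exists_comparison_maps (F G : MinimalGradedFreeResolution K n 𝓜)
    (H : ∀ a, ∃ u, G.ε u = F.ε (Pi.single a 1) ∧ IsHomogeneousVec (G.deg 0) (F.deg 0 a) u)
    (i : ℕ) :
    ∃ (φ : (Fin (F.rank i) → MvPolynomial (Fin n) K) →ₗ[MvPolynomial (Fin n) K]
        (Fin (G.rank i) → MvPolynomial (Fin n) K))
      (ψ : (Fin (G.rank i) → MvPolynomial (Fin n) K) →ₗ[MvPolynomial (Fin n) K]
        (Fin (F.rank i) → MvPolynomial (Fin n) K)),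
      (∀ a, IsHomogeneousVec (G.deg i) (F.deg i a) (φ (Pi.single a 1))) ∧
      (∀ x, F.IsCycle i x → G.IsCycle i (φ x)) ∧ (∀ x, G.IsCycle i x → F.IsCycle i (ψ x)) ∧
      F.IsHomotopicIdAt i (ψ ∘ₗ φ) ∧ G.IsHomotopicIdAt i (φ ∘ₗ ψ) := by
  induction i with
  | zero =>
    obtain ⟨φ, hφ, hφ'⟩ := exists_lift_on_basis G.ε F.ε _ H
    obtain ⟨ψ, hψ⟩ := exists_lift F.ε G.ε fun v => F.ε_surjective _
    refine ⟨φ, ψ, hφ', fun x hx => (hφ x).trans hx, fun x hx => (hψ x).trans hx,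
      F.isHomotopicIdAt_zero _ fun x => ?_, G.isHomotopicIdAt_zero _ fun x => ?_⟩
    · simp [hφ, hψ]
    · simp [hφ, hψ]
  | succ i ih =>
    obtain ⟨φ, ψ, hom, hφ, hψ, hF, hG⟩ := ih
    have e1 : ∀ v, ∃ u, G.d i u = φ (F.d i v) := fun v =>
      (G.isCycle_iff i _).1 (hφ _ ((F.isCycle_iff i _).2 ⟨v, rfl⟩))
    have e2 : ∀ v, ∃ u, F.d i u = ψ (G.d i v) := fun v =>
      (F.isCycle_iff i _).1 (hψ _ ((G.isCycle_iff i _).2 ⟨v, rfl⟩))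
    obtain ⟨ψ', hψ'⟩ := exists_lift (F.d i) (ψ ∘ₗ G.d i) e2
    obtain ⟨φ', hφ', hom'⟩ := exists_lift_on_basis (G.d i) (φ ∘ₗ F.d i)
      (fun a => IsHomogeneousVec (G.deg (i + 1)) (F.deg (i + 1) a)) fun a => by
        obtain ⟨u, hu⟩ := e1 (Pi.single a 1)
        rw [LinearMap.comp_apply, ← hu]
        refine exists_isHomogeneousVec_map_eq (G.d i) (deg' := G.deg i)
          (fun b c => G.d_homogeneous i c b) ?_
        rw [hu]
        exact IsHomogeneousVec.map hom fun c => F.d_homogeneous i c a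
    simp only [LinearMap.comp_apply] at hφ' hψ'
    refine ⟨φ', ψ', hom', fun x hx => ?_, fun x hx => ?_, hF.succ fun x => ?_, hG.succ fun x => ?_⟩
    · have hx : F.d i x = 0 := hx
      change G.d i _ = 0
      rw [hφ', hx, map_zero]
    · have hx : G.d i x = 0 := hx
      change F.d i _ = 0
      rw [hψ', hx, map_zero]
    · simp [hψ', hφ']
    · simp [hψ', hφ']

/-- Modulo the variables, ψφ = id and φψ = id, so the matrix of constant terms of φ has no zero
column and no zero row. A nonzero constant term in a homogeneous map joins basis elements of equal
degree. -/
theorem exists_deg_eq_iff (F G : MinimalGradedFreeResolution K n 𝓜)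
    (H : ∀ a, ∃ u, G.ε u = F.ε (Pi.single a 1) ∧ IsHomogeneousVec (G.deg 0) (F.deg 0 a) u)
    (i j : ℕ) : (∃ a, F.deg i a = j) ↔ ∃ b, G.deg i b = j := by
  obtain ⟨φ, ψ, hom, -, -, ⟨-, hF⟩, -, hG⟩ := exists_comparison_maps F G H i
  have key : ∀ a b, constantCoeff (φ (Pi.single a 1) b) ≠ 0 → F.deg i a = G.deg i b := by
    intro a b hab
    rcases hom a b with h | ⟨e, he, h⟩
    · exact absurd (by rw [h, map_zero]) hab
    · rcases Nat.eq_zero_or_pos e with rfl | he'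
      · simpa using he
      · refine absurd ?_ hab
        rw [constantCoeff_eq]
        by_contra h0
        have := h h0
        simp at this
        omega
  constructor
  · rintro ⟨a, rfl⟩
    by_contra! hne
    have h0 : ∀ b, constantCoeff (φ (Pi.single a 1) b) = 0 := fun b =>
      by_contra fun h => hne b (key a b h).symm
    have h1 := hF (Pi.single a 1) a
    rw [LinearMap.comp_apply, constantCoeff_map_eq_zero ψ h0] at h1
    simp at h1
  -- Here it is row `b` of `φ` that would vanish modulo the variables, contradicting φψ = id.
  · rintro ⟨b, rfl⟩
    by_contra! hne
    have h0 : ∀ a, constantCoeff (φ (Pi.single a 1) b) = 0 := fun a =>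
      by_contra fun h => hne a (key a b h)
    have h1 := hG (Pi.single b 1) b
    rw [LinearMap.comp_apply, map_apply_eq_sum, map_sum,
      Finset.sum_eq_zero fun a _ => by rw [map_mul, h0, mul_zero]] at h1
    simp at h1

theorem betti_ne_zero_congr (F G : MinimalGradedFreeResolution K n 𝓜)
    (H : ∀ a, ∃ u, G.ε u = F.ε (Pi.single a 1) ∧ IsHomogeneousVec (G.deg 0) (F.deg 0 a) u)
    (i j : ℕ) : F.betti i j ≠ 0 ↔ G.betti i j ≠ 0 := by
  rw [betti_ne_zero_iff, betti_ne_zero_iff, exists_deg_eq_iff F G H]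

end MinimalGradedFreeResolution

end Comparison

/-! ### The explicit resolution -/

noncomputable section ExplicitResolution

variable {K : Type*} [Field K] {n : ℕ}

theorem funCongrLeft_single {R ι κ : Type*} [CommSemiring R] [DecidableEq ι] [DecidableEq κ]
    (e : ι ≃ κ) (b : κ) :
    LinearEquiv.funCongrLeft R R e (Pi.single b 1) = Pi.single (e.symm b) 1 := by
  funext x
  simp [LinearEquiv.funCongrLeft_apply, LinearMap.funLeft_apply, Pi.single_apply,
    Equiv.eq_symm_apply]

namespace MinimalGradedFreeResolution

variable {M : Type*} [AddCommGroup M] [Module (MvPolynomial (Fin n) K) M]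
  {𝓜 : ℕ → AddSubgroup M}

/-- A minimal graded free resolution whose bases are indexed by finite types. -/
def ofFintype (ι : ℕ → Type) [∀ i, Fintype (ι i)] [∀ i, DecidableEq (ι i)]
    (deg : (i : ℕ) → ι i → ℕ)
    (d : (i : ℕ) → (ι (i + 1) → MvPolynomial (Fin n) K) →ₗ[MvPolynomial (Fin n) K]
      (ι i → MvPolynomial (Fin n) K))
    (ε : (ι 0 → MvPolynomial (Fin n) K) →ₗ[MvPolynomial (Fin n) K] M)
    (hd : ∀ i b, IsHomogeneousVec (deg i) (deg (i + 1) b) (d i (Pi.single b 1)))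
    (hdeg : ∀ i a b, deg i a < deg (i + 1) b)
    (hε : ∀ a, ε (Pi.single a 1) ∈ 𝓜 (deg 0 a))
    (hsurj : Function.Surjective ε) (h0 : Function.Exact (d 0) ε)
    (h1 : ∀ i, Function.Exact (d (i + 1)) (d i)) : MinimalGradedFreeResolution K n 𝓜 where
  rank i := Fintype.card (ι i)
  deg i a := deg i ((Fintype.equivFin (ι i)).symm a)
  d i := (LinearEquiv.funCongrLeft (MvPolynomial (Fin n) K) (MvPolynomial (Fin n) K)
      (Fintype.equivFin (ι i)).symm).toLinearMap ∘ₗ d i ∘ₗ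
      (LinearEquiv.funCongrLeft (MvPolynomial (Fin n) K) (MvPolynomial (Fin n) K)
      (Fintype.equivFin (ι (i + 1)))).toLinearMap
  ε := ε ∘ₗ (LinearEquiv.funCongrLeft (MvPolynomial (Fin n) K) (MvPolynomial (Fin n) K)
      (Fintype.equivFin (ι 0))).toLinearMap
  d_homogeneous i a b := by
    simp only [LinearMap.comp_apply, LinearEquiv.coe_coe, funCongrLeft_single]
    exact hd i _ _
  ε_homogeneous a := by
    simp only [LinearMap.comp_apply, LinearEquiv.coe_coe, funCongrLeft_single]
    exact hε _
  ε_surjective := hsurj.comp (LinearEquiv.surjective _)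
  exact_zero v := by
    obtain ⟨w, rfl⟩ := (LinearEquiv.funCongrLeft (MvPolynomial (Fin n) K)
      (MvPolynomial (Fin n) K) (Fintype.equivFin (ι 0)).symm).surjective v
    have e : ∀ x : ι 0 → MvPolynomial (Fin n) K, (LinearEquiv.funCongrLeft
        (MvPolynomial (Fin n) K) (MvPolynomial (Fin n) K) (Fintype.equivFin (ι 0)))
        (LinearEquiv.funCongrLeft (MvPolynomial (Fin n) K)
      (MvPolynomial (Fin n) K) (Fintype.equivFin (ι 0)).symm x) = x := fun x =>
      LinearEquiv.apply_symm_apply _ x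
    simp only [LinearMap.comp_apply, LinearEquiv.coe_coe, e, h0 w]
    constructor
    · rintro ⟨y, rfl⟩
      obtain ⟨z, rfl⟩ := (LinearEquiv.funCongrLeft (MvPolynomial (Fin n) K)
        (MvPolynomial (Fin n) K) (Fintype.equivFin (ι 1))).surjective y
      exact ⟨z, rfl⟩
    · rintro ⟨y, hy⟩
      simp only [LinearMap.comp_apply, LinearEquiv.coe_coe] at hy
      exact ⟨_, LinearEquiv.injective _ hy⟩
  exact_succ i v := by
    obtain ⟨w, rfl⟩ := (LinearEquiv.funCongrLeft (MvPolynomial (Fin n) K)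
      (MvPolynomial (Fin n) K) (Fintype.equivFin (ι (i + 1))).symm).surjective v
    have e : ∀ x : ι (i + 1) → MvPolynomial (Fin n) K, (LinearEquiv.funCongrLeft
        (MvPolynomial (Fin n) K) (MvPolynomial (Fin n) K) (Fintype.equivFin (ι (i + 1))))
        (LinearEquiv.funCongrLeft (MvPolynomial (Fin n) K)
      (MvPolynomial (Fin n) K) (Fintype.equivFin (ι (i + 1))).symm x) = x := fun x =>
      LinearEquiv.apply_symm_apply _ x
    simp only [LinearMap.comp_apply, LinearEquiv.coe_coe, e, LinearEquiv.map_eq_zero_iff, h1 i w]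
    constructor
    · rintro ⟨y, rfl⟩
      obtain ⟨z, rfl⟩ := (LinearEquiv.funCongrLeft (MvPolynomial (Fin n) K)
        (MvPolynomial (Fin n) K) (Fintype.equivFin (ι (i + 1 + 1)))).surjective y
      exact ⟨z, rfl⟩
    · rintro ⟨y, hy⟩
      simp only [LinearMap.comp_apply, LinearEquiv.coe_coe] at hy
      exact ⟨_, LinearEquiv.injective _ hy⟩
  minimal i v a := by
    simp only [LinearMap.comp_apply, LinearEquiv.coe_coe, LinearEquiv.funCongrLeft_apply,
      LinearMap.funLeft_apply]
    rw [map_apply_eq_sum (d i), map_sum]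
    refine Finset.sum_eq_zero fun b _ => ?_
    rw [map_mul]
    rcases hd i b ((Fintype.equivFin (ι i)).symm a) with h | ⟨e, he, h⟩
    · rw [h, map_zero, mul_zero]
    · have h2 : constantCoeff (d i (Pi.single b 1) ((Fintype.equivFin (ι i)).symm a)) = 0 := by
        rw [constantCoeff_eq]
        by_contra h3
        have h4 := h h3
        have h5 := hdeg i ((Fintype.equivFin (ι i)).symm a) b
        simp at h4
        omega
      rw [h2, mul_zero]

end MinimalGradedFreeResolution

/-! ### Shifted diagrams and their syzygies -/

/-- The boxes of a shifted diagram: the full first row (indexed by `Fin n`, the row of `base`),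
and in the other rows the boxes on and off the diagonal. -/
structure ShiftedDiagram (n : ℕ) where
  base : Fin n
  diag : Finset (Fin n)
  off : Finset (Fin n × Fin n)
  base_le : ∀ j, base ≤ j
  base_lt_diag : ∀ i ∈ diag, base < i
  base_lt_off : ∀ t ∈ off, base < t.1
  off_lt : ∀ t ∈ off, t.1 < t.2

namespace ShiftedDiagram

variable (S : ShiftedDiagram n)

/-- The boxes of the diagram. -/
abbrev Box : Type := Fin n ⊕ S.diag ⊕ S.off

/-- The indices of the first syzygies. -/
abbrev Syz : Type := {j : Fin n // S.base < j} ⊕ S.diag ⊕ S.off ⊕ S.off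

/-- The exponent vector of the quadratic monomial of a box. -/
def expo : S.Box → Fin n →₀ ℕ
  | .inl j => Finsupp.single S.base 1 + Finsupp.single j 1
  | .inr (.inl i) => Finsupp.single i.1 1 + Finsupp.single i.1 1
  | .inr (.inr t) => Finsupp.single t.1.1 1 + Finsupp.single t.1.2 1

variable (K) in
/-- The monomial ideal generated by the `x ^ (a - f)`, `f` the monomial of a box. -/
def dualIdeal (a : Fin n →₀ ℕ) : Ideal (MvPolynomial (Fin n) K) :=
  Ideal.span (Set.range fun g : S.Box => monomial (a - S.expo g) (1 : K))

variable (K) in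
/-- The generators, as a map from the free module on the boxes. -/
def d₀ (a : Fin n →₀ ℕ) : (S.Box → MvPolynomial (Fin n) K) →ₗ[MvPolynomial (Fin n) K]
    (Unit → MvPolynomial (Fin n) K) :=
  Fintype.linearCombination _ fun g _ => monomial (a - S.expo g) 1

variable (K) in
/-- The first syzygies of the generators. -/
def syz : S.Syz → S.Box → MvPolynomial (Fin n) K
  | .inl j => (X j.1 : MvPolynomial (Fin n) K) • Pi.single (.inl j.1) 1 -
      (X S.base : MvPolynomial (Fin n) K) • Pi.single (.inl S.base) 1
  | .inr (.inl i) => (X i.1 : MvPolynomial (Fin n) K) • Pi.single (.inr (.inl i)) 1 -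
      (X S.base : MvPolynomial (Fin n) K) • Pi.single (.inl i.1) 1
  | .inr (.inr (.inl t)) => (X t.1.2 : MvPolynomial (Fin n) K) • Pi.single (.inr (.inr t)) 1 -
      (X S.base : MvPolynomial (Fin n) K) • Pi.single (.inl t.1.1) 1
  | .inr (.inr (.inr t)) => (X t.1.1 : MvPolynomial (Fin n) K) • Pi.single (.inr (.inr t)) 1 -
      (X S.base : MvPolynomial (Fin n) K) • Pi.single (.inl t.1.2) 1

variable (K) in
/-- The first syzygies, as a map of free modules. -/
def d₁ : (S.Syz → MvPolynomial (Fin n) K) →ₗ[MvPolynomial (Fin n) K]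
    (S.Box → MvPolynomial (Fin n) K) :=
  Fintype.linearCombination _ (S.syz K)

theorem base_lt_off_snd (t : S.off) : S.base < t.1.2 :=
  (S.base_lt_off t.1 t.2).trans (S.off_lt t.1 t.2)

variable (K) in
/-- The second syzygies of the generators. -/
def syzSyz (t : S.off) : S.Syz → MvPolynomial (Fin n) K :=
  ((X t.1.1 : MvPolynomial (Fin n) K) • Pi.single (.inr (.inr (.inl t))) 1 -
    (X t.1.2 : MvPolynomial (Fin n) K) • Pi.single (.inr (.inr (.inr t))) 1) +
  ((X S.base : MvPolynomial (Fin n) K) • Pi.single (.inl ⟨t.1.1, S.base_lt_off t.1 t.2⟩) 1 -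
    (X S.base : MvPolynomial (Fin n) K) • Pi.single (.inl ⟨t.1.2, S.base_lt_off_snd t⟩) 1)

variable (K) in
/-- The second syzygies, as a map of free modules. -/
def d₂ : (S.off → MvPolynomial (Fin n) K) →ₗ[MvPolynomial (Fin n) K]
    (S.Syz → MvPolynomial (Fin n) K) :=
  Fintype.linearCombination _ (S.syzSyz K)

theorem d₁_single (g : S.Syz) : S.d₁ K (Pi.single g 1) = S.syz K g := by
  simp [d₁, Fintype.linearCombination_apply_single]

theorem d₂_single (t : S.off) : S.d₂ K (Pi.single t 1) = S.syzSyz K t := by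
  simp [d₂, Fintype.linearCombination_apply_single]

theorem d₀_single (a : Fin n →₀ ℕ) (g : S.Box) :
    S.d₀ K a (Pi.single g 1) = fun _ => monomial (a - S.expo g) 1 := by
  simp [d₀, Fintype.linearCombination_apply_single]

theorem d₁_d₂ (z : S.off → MvPolynomial (Fin n) K) : S.d₁ K (S.d₂ K z) = 0 := by
  have h : S.d₁ K ∘ₗ S.d₂ K = 0 := by
    apply LinearMap.pi_ext'
    intro t
    apply LinearMap.ext_ring
    simp only [LinearMap.comp_apply, LinearMap.single_apply, d₂_single, syzSyz, map_add, map_sub,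
      map_smul, d₁_single, syz, LinearMap.zero_apply]
    module
  exact LinearMap.congr_fun h z

theorem X_mul_monomial_sub (a : Fin n →₀ ℕ) {i j : Fin n}
    (h : Finsupp.single i 1 + Finsupp.single j 1 ≤ a) :
    (X j * monomial (a - (Finsupp.single i 1 + Finsupp.single j 1)) 1 : MvPolynomial (Fin n) K) =
      monomial (a - Finsupp.single i 1) 1 := by
  rw [X, monomial_mul, one_mul]
  congr 2
  ext k
  have := h k
  simp only [Finsupp.add_apply, Finsupp.tsub_apply] at this ⊢
  omega

variable {a : Fin n →₀ ℕ}

theorem d₀_d₁ (ha : ∀ g, S.expo g ≤ a) (z : S.Syz → MvPolynomial (Fin n) K) :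
    S.d₀ K a (S.d₁ K z) = 0 := by
  have key : ∀ {i j : Fin n}, Finsupp.single i 1 + Finsupp.single j 1 ≤ a → ∀ {f : Fin n →₀ ℕ},
      f = Finsupp.single i 1 + Finsupp.single j 1 →
      (X j * monomial (a - f) 1 : MvPolynomial (Fin n) K) =
      monomial (a - Finsupp.single i 1) 1 := by
    rintro i j h f rfl
    exact X_mul_monomial_sub a h
  have h : S.d₀ K a ∘ₗ S.d₁ K = 0 := by
    apply LinearMap.pi_ext'
    intro t
    apply LinearMap.ext_ring
    funext x
    rcases t with j | i | t | t <;>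
    simp only [LinearMap.comp_apply, LinearMap.single_apply, d₁_single, syz, map_sub,
      map_smul, d₀_single, LinearMap.zero_apply, Pi.sub_apply, Pi.smul_apply, smul_eq_mul,
      Pi.zero_apply, sub_eq_zero]
    · rw [key (f := S.expo (.inl j.1)) (ha (.inl j.1)) rfl,
        key (f := S.expo (.inl S.base)) (ha (.inl S.base)) rfl]
    · have h1 := ha (.inl i.1)
      rw [key (f := S.expo (.inr (.inl i))) (ha (.inr (.inl i))) rfl,
        key (i := i.1) (j := S.base) (f := S.expo (.inl i.1)) (by rwa [add_comm]) (add_comm _ _)]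
    · have h1 := ha (.inl t.1.1)
      rw [key (f := S.expo (.inr (.inr t))) (ha (.inr (.inr t))) rfl,
        key (i := t.1.1) (j := S.base) (f := S.expo (.inl t.1.1)) (by rwa [add_comm])
          (add_comm _ _)]
    · have h1 := ha (.inl t.1.2)
      have h2 := ha (.inr (.inr t))
      rw [key (i := t.1.2) (j := t.1.1) (f := S.expo (.inr (.inr t))) (by rwa [add_comm])
          (add_comm _ _),
        key (i := t.1.2) (j := S.base) (f := S.expo (.inl t.1.2)) (by rwa [add_comm])
          (add_comm _ _)]
  exact LinearMap.congr_fun h z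

theorem d₂_apply_inl (y : S.off → MvPolynomial (Fin n) K) (t : S.off) :
    S.d₂ K y (.inr (.inr (.inl t))) = y t * X t.1.1 := by
  simp [d₂, Fintype.linearCombination_apply, syzSyz, Pi.single_apply, Finset.sum_apply]

theorem d₂_apply_inr (y : S.off → MvPolynomial (Fin n) K) (t : S.off) :
    S.d₂ K y (.inr (.inr (.inr t))) = -(y t * X t.1.2) := by
  simp [d₂, Fintype.linearCombination_apply, syzSyz, Pi.single_apply, Finset.sum_apply]

theorem d₁_apply_diag (z : S.Syz → MvPolynomial (Fin n) K) (i : S.diag) :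
    S.d₁ K z (.inr (.inl i)) = z (.inr (.inl i)) * X i.1 := by
  simp [d₁, Fintype.linearCombination_apply, syz, Pi.single_apply, Finset.sum_apply]

theorem d₁_apply_off (z : S.Syz → MvPolynomial (Fin n) K) (t : S.off) :
    S.d₁ K z (.inr (.inr t)) =
      z (.inr (.inr (.inl t))) * X t.1.2 + z (.inr (.inr (.inr t))) * X t.1.1 := by
  simp [d₁, Fintype.linearCombination_apply, syz, Pi.single_apply, Finset.sum_apply]

/-- Once only the row syzygies remain, each box beyond the base one is met by a single syzygy, so
the matrix is diagonal there. -/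
theorem d₁_apply_row (z : S.Syz → MvPolynomial (Fin n) K) (hz : ∀ g, z (.inr g) = 0)
    (j : {j : Fin n // S.base < j}) :
    S.d₁ K z (.inl j.1) = z (.inl j) * X j.1 := by
  have h : ∀ k : {j : Fin n // S.base < j}, (j.1 = k.1) ↔ j = k := fun k => Subtype.ext_iff.symm
  simp [d₁, Fintype.linearCombination_apply, syz, Pi.single_apply, Finset.sum_apply, hz, h,
    j.2.ne']

/-! ### Exactness of the complex -/

theorem d₂_injective : Function.Injective (S.d₂ K) := by
  rw [injective_iff_map_eq_zero]
  intro y hy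
  funext t
  have := S.d₂_apply_inl y t
  rw [hy] at this
  simpa [X_ne_zero] using this.symm

theorem exact_d₂_d₁ : Function.Exact (S.d₂ K) (S.d₁ K) := by
  intro z
  refine ⟨fun hz => ?_, ?_⟩
  swap
  · rintro ⟨y, rfl⟩
    exact S.d₁_d₂ y
  -- The coordinate of a cycle at an off-diagonal box is a relation between two distinct variables,
  -- hence a Koszul relation; `y` is its multiplier.
  have h1 : ∀ t : S.off, ∃ y, z (.inr (.inr (.inl t))) = X t.1.1 * y := by
    intro t
    have h := S.d₁_apply_off z t
    rw [hz] at h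
    have h2 : (X t.1.1 : MvPolynomial (Fin n) K) ∣ z (.inr (.inr (.inl t))) * X t.1.2 :=
      ⟨-z (.inr (.inr (.inr t))), by
        rw [Pi.zero_apply] at h
        linear_combination -h⟩
    rcases X_dvd_mul_iff.1 h2 with h3 | h3
    · exact h3
    · exact absurd (X_dvd_X.1 h3) (S.off_lt t.1 t.2).ne
  choose y hy using h1
  refine ⟨y, ?_⟩
  have hw : S.d₁ K (z - S.d₂ K y) = 0 := by rw [map_sub, hz, d₁_d₂, sub_zero]
  have hinr : ∀ g, (z - S.d₂ K y) (.inr g) = 0 := by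
    rintro (i | t | t)
    · have h := S.d₁_apply_diag (z - S.d₂ K y) i
      rw [hw] at h
      simpa [X_ne_zero] using h.symm
    · rw [Pi.sub_apply, d₂_apply_inl, hy]
      ring
    · have h := S.d₁_apply_off z t
      rw [hz, hy, Pi.zero_apply] at h
      have h2 : (z (.inr (.inr (.inr t))) + y t * X t.1.2) * X t.1.1 = 0 := by
        linear_combination -h
      rw [Pi.sub_apply, d₂_apply_inr]
      simpa [X_ne_zero] using h2
  have h0 : z - S.d₂ K y = 0 := by
    funext g
    rcases g with j | g
    · have h := S.d₁_apply_row _ hinr j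
      rw [hw] at h
      simpa [X_ne_zero] using h.symm
    · exact hinr g
  exact (sub_eq_zero.1 h0).symm

theorem d₀_apply (c : S.Box → MvPolynomial (Fin n) K) (x : Unit) :
    S.d₀ K a c x = ∑ g, c g * monomial (a - S.expo g) 1 := by
  simp [d₀, Fintype.linearCombination_apply, Finset.sum_apply]

/-- The term x^e of `c g` contributes to the monomial e + (a - f_g) of the relation. Another box g'
can reach that monomial only if f_g divides f_{g'} x^e; without such a competitor nothing cancels
the term. -/
theorem coeff_eq_zero_of_d₀_eq_zero (ha : ∀ g, S.expo g ≤ a)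
    {c : S.Box → MvPolynomial (Fin n) K} (hc : S.d₀ K a c = 0) (g : S.Box) (e : Fin n →₀ ℕ)
    (h : ∀ g', c g' ≠ 0 → S.expo g ≤ S.expo g' + e → g' = g) : coeff e (c g) = 0 := by
  have h1 := congrArg (coeff (e + (a - S.expo g))) (congrFun hc ())
  rw [d₀_apply, coeff_sum, Finset.sum_eq_single g, coeff_mul_monomial, mul_one] at h1
  · simpa using h1
  · intro g' _ hg'
    rw [coeff_mul_monomial']
    split_ifs with h2
    · have h3 : S.expo g ≤ S.expo g' + e := by
        intro k
        have h4 := h2 k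
        have h5 := ha g k
        have h6 := ha g' k
        simp only [Finsupp.add_apply, Finsupp.tsub_apply] at h4 ⊢
        omega
      have h7 : c g' = 0 := by_contra fun h8 => hg' (h g' h8 h3)
      simp [h7]
    · rfl
  · simp

theorem exact_d₁_d₀ (ha : ∀ g, S.expo g ≤ a) : Function.Exact (S.d₁ K) (S.d₀ K a) := by
  intro c
  refine ⟨fun hc => ?_, ?_⟩
  swap
  · rintro ⟨y, rfl⟩
    exact S.d₀_d₁ ha y
  -- If x^e is free of x_i, a competitor must itself be divisible by x_i², and only this diagonal
  -- box is.
  have hdiag : ∀ i : S.diag, ∃ w, c (.inr (.inl i)) = w * X i.1 := by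
    intro i
    have h1 : c (.inr (.inl i)) ∈ Ideal.span (X '' {i.1}) := by
      rw [mem_ideal_span_X_image]
      intro e he
      by_contra! h0
      simp only [Set.mem_singleton_iff, forall_eq] at h0
      refine mem_support_iff.1 he (S.coeff_eq_zero_of_d₀_eq_zero ha hc _ e ?_)
      intro g' _ hg'
      have h2 := hg' i.1
      have hi := (S.base_lt_diag i.1 i.2).ne
      rcases g' with j | i' | t
      · simp [expo, h0, Finsupp.single_apply, hi] at h2
        split_ifs at h2 <;> omega
      · have : i'.1 = i.1 := by
          by_contra h3
          simp [expo, h0, h3] at h2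
        rw [Subtype.ext this]
      · have := (S.off_lt t.1 t.2).ne
        simp [expo, h0, Finsupp.single_apply] at h2
        split_ifs at h2 <;> simp_all
    rw [Set.image_singleton, Ideal.mem_span_singleton'] at h1
    obtain ⟨w, hw⟩ := h1
    exact ⟨w, hw.symm⟩
  -- If x^e avoids both variables of the box, a competitor must contain both, hence is the same box.
  have hoff : ∀ t : S.off, ∃ u v, c (.inr (.inr t)) = u * X t.1.2 + v * X t.1.1 := by
    intro t
    have h1 : c (.inr (.inr t)) ∈ Ideal.span (X '' {t.1.2, t.1.1}) := by
      rw [mem_ideal_span_X_image]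
      intro e he
      by_contra! h0
      simp only [Set.mem_insert_iff, Set.mem_singleton_iff, forall_eq_or_imp, forall_eq] at h0
      refine mem_support_iff.1 he (S.coeff_eq_zero_of_d₀_eq_zero ha hc _ e ?_)
      intro g' _ hg'
      have h2 := hg' t.1.1
      have h3 := hg' t.1.2
      have ht := S.off_lt t.1 t.2
      have ht1 := (S.base_lt_off t.1 t.2).ne
      have ht2 := (S.base_lt_off_snd t).ne
      rcases g' with j | i' | t'
      · simp [expo, h0, Finsupp.single_apply, ht1, ht2] at h2 h3
        grind
      · simp [expo, h0, Finsupp.single_apply] at h2 h3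
        grind
      · have ht' := S.off_lt t'.1 t'.2
        simp [expo, h0, Finsupp.single_apply] at h2 h3
        have : t'.1 = t.1 := by
          ext1 <;> grind
        rw [Subtype.ext this]
    rw [Set.image_pair, Ideal.mem_span_pair] at h1
    obtain ⟨u, v, hw⟩ := h1
    exact ⟨u, v, hw.symm⟩
  choose w hw using hdiag
  choose u v huv using hoff
  let z : S.Syz → MvPolynomial (Fin n) K := Sum.elim 0 (Sum.elim w (Sum.elim u v))
  have hinr : ∀ g, (c - S.d₁ K z) (.inr g) = 0 := by
    rintro (i | t)
    · rw [Pi.sub_apply, d₁_apply_diag, hw]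
      simp [z]
    · rw [Pi.sub_apply, d₁_apply_off, huv]
      simp [z]
  have hc' : S.d₀ K a (c - S.d₁ K z) = 0 := by rw [map_sub, hc, d₀_d₁ S ha, sub_zero]
  generalize hcz : c - S.d₁ K z = c' at hinr hc'
  -- With only first-row coordinates left, x_b x_j is the only box containing x_j.
  have hrow : ∀ j : {j : Fin n // S.base < j}, ∃ s, c' (.inl j.1) = s * X j.1 := by
    intro j
    have h1 : c' (.inl j.1) ∈ Ideal.span (X '' {j.1}) := by
      rw [mem_ideal_span_X_image]
      intro e he
      by_contra! h0
      simp only [Set.mem_singleton_iff, forall_eq] at h0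
      refine mem_support_iff.1 he (S.coeff_eq_zero_of_d₀_eq_zero ha hc' _ e ?_)
      intro g' hne hg'
      have h2 := hg' j.1
      have hj := j.2.ne
      rcases g' with j' | g'
      · by_contra h3
        have h4 : j' ≠ j.1 := fun h => h3 (by rw [h])
        simp [expo, h0, hj, h4] at h2
      · exact absurd (hinr g') hne
    rw [Set.image_singleton, Ideal.mem_span_singleton'] at h1
    obtain ⟨w, hw⟩ := h1
    exact ⟨w, hw.symm⟩
  choose s hs using hrow
  let y : S.Syz → MvPolynomial (Fin n) K := Sum.elim s 0
  have hne : ∀ g, g ≠ .inl S.base → (c' - S.d₁ K y) g = 0 := by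
    rintro (j | i | t) hg
    · have hj : S.base < j := lt_of_le_of_ne (S.base_le j) fun h => hg (by rw [h])
      have := S.d₁_apply_row y (fun g => rfl) ⟨j, hj⟩
      rw [Pi.sub_apply, this, hs ⟨j, hj⟩]
      simp [y]
    · rw [Pi.sub_apply, d₁_apply_diag, hinr]
      simp [y]
    · rw [Pi.sub_apply, d₁_apply_off, hinr]
      simp [y]
  have hc'' : S.d₀ K a (c' - S.d₁ K y) = 0 := by rw [map_sub, hc', d₀_d₁ S ha, sub_zero]
  -- Only the coordinate at x_b² survives, and a single nonzero monomial generator has no syzygy.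
  have h0 : c' - S.d₁ K y = 0 := by
    funext g
    by_cases hg : g = .inl S.base
    · subst hg
      have h := congrFun hc'' ()
      rw [d₀_apply, Finset.sum_eq_single (.inl S.base)
        (fun g _ hg => by rw [hne g hg, zero_mul]) (by simp)] at h
      simpa [monomial_eq_zero] using h
    · exact hne g hg
  exact ⟨z + y, by rw [map_add, ← sub_eq_zero.1 h0, ← hcz]; abel⟩

/-! ### Assembly and comparison with an arbitrary resolution -/

/-- The index types of the bases of the explicit resolution. -/
def Index : ℕ → Type
  | 0 => Unit
  | 1 => S.Box
  | 2 => S.Syz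
  | 3 => S.off
  | _ + 4 => Empty

instance : ∀ i, Fintype (S.Index i)
  | 0 => inferInstanceAs (Fintype Unit)
  | 1 => inferInstanceAs (Fintype S.Box)
  | 2 => inferInstanceAs (Fintype S.Syz)
  | 3 => inferInstanceAs (Fintype S.off)
  | _ + 4 => inferInstanceAs (Fintype Empty)

instance : ∀ i, DecidableEq (S.Index i)
  | 0 => inferInstanceAs (DecidableEq Unit)
  | 1 => inferInstanceAs (DecidableEq S.Box)
  | 2 => inferInstanceAs (DecidableEq S.Syz)
  | 3 => inferInstanceAs (DecidableEq S.off)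
  | _ + 4 => inferInstanceAs (DecidableEq Empty)

/-- The degrees of the basis elements of the explicit resolution, `a` of degree `D`. -/
def degree (D : ℕ) : (i : ℕ) → S.Index i → ℕ
  | 0, _ => 0
  | i + 1, _ => D - 2 + i

variable (K) in
/-- The differentials of the explicit resolution. -/
def differential (a : Fin n →₀ ℕ) : (i : ℕ) →
    (S.Index (i + 1) → MvPolynomial (Fin n) K) →ₗ[MvPolynomial (Fin n) K]
      (S.Index i → MvPolynomial (Fin n) K)
  | 0 => S.d₀ K a
  | 1 => S.d₁ K
  | 2 => S.d₂ K
  | _ + 3 => 0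

theorem degree_expo (g : S.Box) : (S.expo g).degree = 2 := by
  rcases g with j | i | t <;> simp [expo, map_add, Finsupp.degree_single]

theorem isHomogeneous_X_smul_single {ι : Type*} [DecidableEq ι] (j : Fin n) (g b : ι) :
    (((X j : MvPolynomial (Fin n) K) • (Pi.single g 1 : ι → MvPolynomial (Fin n) K)) b
      ).IsHomogeneous 1 := by
  rw [Pi.smul_apply, Pi.single_apply]
  split_ifs
  · simpa using isHomogeneous_X K j
  · simpa using isHomogeneous_zero (Fin n) K 1

theorem isHomogeneous_syz (g : S.Syz) (b : S.Box) : (S.syz K g b).IsHomogeneous 1 := by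
  rcases g with j | i | t | t <;>
  exact (isHomogeneous_X_smul_single _ _ _).sub (isHomogeneous_X_smul_single _ _ _)

theorem isHomogeneous_syzSyz (t : S.off) (g : S.Syz) : (S.syzSyz K t g).IsHomogeneous 1 :=
  ((isHomogeneous_X_smul_single _ _ _).sub (isHomogeneous_X_smul_single _ _ _)).add
    ((isHomogeneous_X_smul_single _ _ _).sub (isHomogeneous_X_smul_single _ _ _))

theorem isHomogeneousVec_differential (ha : ∀ g, S.expo g ≤ a) (i : ℕ) (b : S.Index (i + 1)) :
    IsHomogeneousVec (S.degree a.degree i) (S.degree a.degree (i + 1) b)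
      (S.differential K a i (Pi.single b 1)) := by
  intro c
  right
  match i, b, c with
  | 0, b, c =>
    refine ⟨a.degree - 2, by simp [degree], ?_⟩
    have h : S.differential K a 0 (Pi.single b 1) c = monomial (a - S.expo b) 1 :=
      congrFun (S.d₀_single a b) c
    rw [h]
    refine isHomogeneous_monomial _ ?_
    have h1 : (a - S.expo b).degree + (S.expo b).degree = a.degree := by
      rw [← map_add, tsub_add_cancel_of_le (ha b)]
    have h2 : (S.expo b).degree = 2 := S.degree_expo b
    omega
  | 1, b, c =>
    refine ⟨1, by simp [degree], ?_⟩
    have h : S.differential K a 1 (Pi.single b 1) c = S.syz K b c := congrFun (S.d₁_single b) c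
    rw [h]
    exact S.isHomogeneous_syz b c
  | 2, b, c =>
    refine ⟨1, by simp [degree], ?_⟩
    have h : S.differential K a 2 (Pi.single b 1) c = S.syzSyz K b c := congrFun (S.d₂_single b) c
    rw [h]
    exact S.isHomogeneous_syzSyz b c
  | i + 3, b, c => exact b.elim

variable (K) in
/-- The augmentation of the explicit resolution. -/
def augmentation (a : Fin n →₀ ℕ) :
    (S.Index 0 → MvPolynomial (Fin n) K) →ₗ[MvPolynomial (Fin n) K]
      MvPolynomial (Fin n) K ⧸ S.dualIdeal K a :=
  (S.dualIdeal K a).mkQ ∘ₗ LinearMap.proj ()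

theorem augmentation_apply (v : S.Index 0 → MvPolynomial (Fin n) K) :
    S.augmentation K a v = Ideal.Quotient.mk (S.dualIdeal K a) (v ()) := rfl

theorem exact_d₀_augmentation : Function.Exact (S.d₀ K a) (S.augmentation K a) := by
  intro v
  refine Ideal.Quotient.eq_zero_iff_mem.trans ?_
  rw [dualIdeal, Ideal.mem_span_range_iff_exists_fun]
  refine exists_congr fun c => ?_
  rw [← S.d₀_apply c ()]
  exact ⟨fun h => funext fun _ => h, fun h => congrFun h ()⟩

variable (K) in
/-- The explicit linear minimal free resolution of the quotient by the dual ideal. -/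
def resolution (ha : ∀ g, S.expo g ≤ a) (hdeg : 2 < a.degree) :
    MinimalGradedFreeResolution K n (quotientGrading (S.dualIdeal K a)) :=
  MinimalGradedFreeResolution.ofFintype S.Index (S.degree a.degree) (S.differential K a)
    (S.augmentation K a) (S.isHomogeneousVec_differential ha)
    (by
      rintro (_ | i) b c
      · simp only [degree]
        omega
      · simp only [degree]
        omega)
    (fun u => ⟨1, isHomogeneous_one _ _, by
      have : (Pi.single u 1 : S.Index 0 → MvPolynomial (Fin n) K) () = 1 := Pi.single_eq_same u 1
      rw [augmentation_apply, this]
      rfl⟩)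
    (fun x => by
      obtain ⟨r, rfl⟩ := Ideal.Quotient.mk_surjective x
      exact ⟨fun _ => r, rfl⟩)
    S.exact_d₀_augmentation
    (fun i => match i with
      | 0 => S.exact_d₁_d₀ ha
      | 1 => S.exact_d₂_d₁
      | 2 => fun x => ⟨fun h => ⟨0, by
          rw [map_zero]
          exact (S.d₂_injective (K := K) (h.trans (map_zero _).symm)).symm⟩, by
          rintro ⟨y, rfl⟩
          exact map_zero (S.d₂ K)⟩
      | i + 3 => fun x => ⟨fun _ => ⟨0, funext fun e => e.elim⟩, fun _ => rfl⟩)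

theorem betti_resolution_ne_zero_iff (ha : ∀ g, S.expo g ≤ a) (hdeg : 2 < a.degree) (i j : ℕ) :
    (S.resolution K ha hdeg).betti i j ≠ 0 ↔ ∃ b : S.Index i, S.degree a.degree i b = j := by
  rw [MinimalGradedFreeResolution.betti_ne_zero_iff]
  exact (Fintype.equivFin (S.Index i)).symm.exists_congr_left.trans
    (by simp [resolution, MinimalGradedFreeResolution.ofFintype])

theorem betti_ne_zero_iff (ha : ∀ g, S.expo g ≤ a) (hdeg : 2 < a.degree)
    (F : MinimalGradedFreeResolution K n (quotientGrading (S.dualIdeal K a))) (i j : ℕ) :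
    F.betti i j ≠ 0 ↔ ∃ b : S.Index i, S.degree a.degree i b = j := by
  rw [← betti_resolution_ne_zero_iff S ha hdeg (K := K)]
  refine MinimalGradedFreeResolution.betti_ne_zero_congr F _ (fun c => ?_) i j
  -- The grading consists of images of forms, so a form `r` is a homogeneous lift to the rank-one
  -- module in position 0.
  obtain ⟨r, hr, hr'⟩ := F.ε_homogeneous c
  exact ⟨fun _ => r, hr', fun _ => Or.inr ⟨F.deg 0 c, (Nat.zero_add _).symm, hr⟩⟩

end ShiftedDiagram

end ExplicitResolution

/-! ### The strongly stable ideal -/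

section StronglyStable

variable {K : Type*} [Field K] {m n : ℕ}

/-- The exponent vectors of the quadratic generators of the strongly stable ideal. -/
def stronglyStableExponents (hmn : m ≤ n) (lam : Fin m → ℕ) : Set (Fin n →₀ ℕ) :=
  {s | ∃ (i : Fin m) (j : Fin n), (i : ℕ) ≤ j ∧ (j : ℕ) < lam i ∧
    s = Finsupp.single (Fin.castLE hmn i) 1 + Finsupp.single j 1}

theorem stronglyStableIdeal_eq_span (hmn : m ≤ n) (lam : Fin m → ℕ) :
    stronglyStableIdeal K hmn lam =
      Ideal.span ((fun s => monomial s (1 : K)) '' stronglyStableExponents hmn lam) := by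
  rw [stronglyStableIdeal, generalizedFerrersIdeal, Ideal.map_span]
  congr 1
  ext p
  constructor
  · rintro ⟨_, ⟨i, j, h1, h2, rfl⟩, rfl⟩
    refine ⟨_, ⟨i, j, by omega, by omega, rfl⟩, ?_⟩
    rw [map_mul, specializationMap, rename_X, rename_X, X, X, monomial_mul, one_mul]
    rfl
  · rintro ⟨_, ⟨i, j, h1, h2, rfl⟩, rfl⟩
    refine ⟨_, ⟨i, j, by omega, by omega, rfl⟩, ?_⟩
    rw [map_mul, specializationMap, rename_X, rename_X, X, X, monomial_mul, one_mul]
    rfl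

theorem degree_of_mem_stronglyStableExponents {hmn : m ≤ n} {lam : Fin m → ℕ} {s : Fin n →₀ ℕ}
    (hs : s ∈ stronglyStableExponents hmn lam) : s.degree = 2 := by
  obtain ⟨i, j, -, -, rfl⟩ := hs
  simp [map_add, Finsupp.degree_single]

theorem eq_of_le_of_degree_eq {σ : Type*} {s t : σ →₀ ℕ} (h : s ≤ t) (hd : t.degree = s.degree) :
    s = t := by
  obtain ⟨u, rfl⟩ := exists_add_of_le h
  rw [map_add] at hd
  have : u = 0 := (Finsupp.degree_eq_zero_iff u).1 (by omega)
  rw [this, add_zero]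

theorem minGens_stronglyStableIdeal (hmn : m ≤ n) (lam : Fin m → ℕ) :
    minGens (stronglyStableIdeal K hmn lam) = stronglyStableExponents hmn lam := by
  have key : ∀ b, monomial b (1 : K) ∈ stronglyStableIdeal K hmn lam ↔
      ∃ s ∈ stronglyStableExponents hmn lam, s ≤ b := by
    intro b
    rw [stronglyStableIdeal_eq_span, mem_ideal_span_monomial_image]
    classical simp [support_monomial]
  ext b
  simp only [minGens, Set.mem_ofPred_eq, key]
  constructor
  · rintro ⟨⟨s, hs, hsb⟩, hmin⟩
    exact le_antisymm hsb (hmin ⟨s, hs, le_rfl⟩ hsb) ▸ hs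
  · intro hb
    refine ⟨⟨b, hb, le_rfl⟩, ?_⟩
    rintro c ⟨s, hs, hsc⟩ hcb
    have := eq_of_le_of_degree_eq (hsc.trans hcb)
      ((degree_of_mem_stronglyStableExponents hb).trans
        (degree_of_mem_stronglyStableExponents hs).symm)
    exact this ▸ hsc

/-! ### The lcm and the diagram of the strongly stable ideal -/

/-- The exponent vector of `x_1² ⋯ x_m² x_{m+1} ⋯ x_n`. -/
noncomputable def doubledExponent (m n : ℕ) : Fin n →₀ ℕ :=
  Finsupp.equivFunOnFinite.symm fun j => if (j : ℕ) < m then 2 else 1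

theorem degree_doubledExponent (hmn : m ≤ n) : (doubledExponent m n).degree = n + m := by
  have h : (doubledExponent m n).degree = ∑ j : Fin n, (1 + if (j : ℕ) < m then 1 else 0) := by
    rw [Finsupp.degree_eq_sum]
    refine Finset.sum_congr rfl fun j _ => ?_
    simp only [doubledExponent, Finsupp.equivFunOnFinite_symm_apply_apply]
    split_ifs <;> rfl
  rw [h, Finset.sum_add_distrib, Fin.sum_univ_eq_sum_range (fun j => if j < m then 1 else 0) n]
  have h2 : (Finset.range n).filter (fun j => j < m) = Finset.range m := by
    ext j
    simp only [Finset.mem_filter, Finset.mem_range]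
    omega
  simp [h2]

theorem le_doubledExponent (hmn : m ≤ n) {lam : Fin m → ℕ} {s : Fin n →₀ ℕ}
    (hs : s ∈ stronglyStableExponents hmn lam) : s ≤ doubledExponent m n := by
  obtain ⟨i, j, -, -, rfl⟩ := hs
  intro k
  simp only [doubledExponent, Finsupp.equivFunOnFinite_symm_apply_apply, Finsupp.add_apply,
    Finsupp.single_apply, Fin.ext_iff, Fin.val_castLE]
  have := i.2
  split_ifs <;> omega

theorem lcmExponent_stronglyStableIdeal (hm : 1 < m) (hmn : m ≤ n) (lam : Fin m → ℕ)
    (hlast : ∀ i : Fin m, (i : ℕ) < lam i)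
    (hfirst : lam ⟨0, Nat.lt_of_lt_of_le Nat.zero_lt_one hm.le⟩ = n) :
    lcmExponent (stronglyStableIdeal K hmn lam) = doubledExponent m n := by
  apply le_antisymm
  · refine Finset.sup_le fun s hs => ?_
    rw [Set.Finite.mem_toFinset, minGens_stronglyStableIdeal] at hs
    exact le_doubledExponent hmn hs
  · have hle : ∀ s ∈ stronglyStableExponents hmn lam,
        s ≤ lcmExponent (stronglyStableIdeal K hmn lam) := fun s hs =>
      le_lcmExponent _ (by rwa [minGens_stronglyStableIdeal])
    intro k
    by_cases hk : (k : ℕ) < m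
    -- The square x_k² forces exponent 2 here; beyond the first m variables the first-row generator
    -- x_1 x_k forces exponent 1.
    · refine le_trans ?_ (hle _ ⟨⟨k, hk⟩, k, le_rfl, hlast ⟨k, hk⟩, rfl⟩ k)
      simp [doubledExponent, hk]
    · refine le_trans ?_ (hle _ ⟨⟨0, by omega⟩, k, Nat.zero_le _, k.2.trans_eq hfirst.symm, rfl⟩ k)
      simp [doubledExponent, hk]

/-- The shifted diagram of the strongly stable ideal. -/
def shiftedDiagram (hm : 1 < m) (hmn : m ≤ n) (lam : Fin m → ℕ) : ShiftedDiagram n where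
  base := ⟨0, by omega⟩
  diag := Finset.univ.filter fun i => 0 < (i : ℕ) ∧ (i : ℕ) < m
  off := Finset.univ.filter fun t => 0 < (t.1 : ℕ) ∧ t.1 < t.2 ∧
    ∃ h : (t.1 : ℕ) < m, (t.2 : ℕ) < lam ⟨t.1, h⟩
  base_le j := Nat.zero_le _
  base_lt_diag i hi := (Finset.mem_filter.1 hi).2.1
  base_lt_off t ht := (Finset.mem_filter.1 ht).2.1
  off_lt t ht := (Finset.mem_filter.1 ht).2.2.1

theorem range_expo_shiftedDiagram (hm : 1 < m) (hmn : m ≤ n) (lam : Fin m → ℕ)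
    (hlast : ∀ i : Fin m, (i : ℕ) < lam i)
    (hfirst : lam ⟨0, Nat.lt_of_lt_of_le Nat.zero_lt_one hm.le⟩ = n) :
    Set.range (shiftedDiagram hm hmn lam).expo = stronglyStableExponents hmn lam := by
  ext s
  constructor
  · rintro ⟨j | ⟨i, hi⟩ | ⟨t, ht⟩, rfl⟩
    · exact ⟨⟨0, by omega⟩, j, Nat.zero_le _, j.2.trans_eq hfirst.symm, rfl⟩
    · exact ⟨⟨i, (Finset.mem_filter.1 hi).2.2⟩, i, le_rfl,
        hlast ⟨i, (Finset.mem_filter.1 hi).2.2⟩, rfl⟩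
    · obtain ⟨-, -, h1, h2, h3⟩ := Finset.mem_filter.1 ht
      exact ⟨⟨t.1, h2⟩, t.2, h1.le, h3, rfl⟩
  · rintro ⟨i, j, h1, h2, rfl⟩
    rcases Nat.eq_zero_or_pos (i : ℕ) with hi | hi
    · refine ⟨.inl j, ?_⟩
      have : (⟨0, by omega⟩ : Fin n) = Fin.castLE hmn i := Fin.ext hi.symm
      rw [← this]
      rfl
    · rcases h1.eq_or_lt with h | h
      · have hj : j = Fin.castLE hmn i := Fin.ext h.symm
        subst hj
        exact ⟨.inr (.inl ⟨Fin.castLE hmn i, Finset.mem_filter.2 ⟨Finset.mem_univ _, hi, i.2⟩⟩), rfl⟩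
      · exact ⟨.inr (.inr ⟨(Fin.castLE hmn i, j),
          Finset.mem_filter.2 ⟨Finset.mem_univ _, hi, h, i.2, h2⟩⟩), rfl⟩

theorem lcmDual_stronglyStableIdeal (hm : 1 < m) (hmn : m ≤ n) (lam : Fin m → ℕ)
    (hlast : ∀ i : Fin m, (i : ℕ) < lam i)
    (hfirst : lam ⟨0, Nat.lt_of_lt_of_le Nat.zero_lt_one hm.le⟩ = n) :
    lcmDual (stronglyStableIdeal K hmn lam) =
      (shiftedDiagram hm hmn lam).dualIdeal K (doubledExponent m n) := by
  rw [lcmDual, lcmExponent_stronglyStableIdeal hm hmn lam hlast hfirst,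
    minGens_stronglyStableIdeal, ← range_expo_shiftedDiagram hm hmn lam hlast hfirst,
    ← Set.range_comp]
  rfl

/-- By monotonicity of λ, any off-diagonal box below the first row forces the box of x_2 x_3, at
zero-based position (1, 2), to be present. -/
theorem nonempty_off_iff (hm : 1 < m) (hmn : m ≤ n) (lam : Fin m → ℕ) (hlam : Antitone lam)
    (hfirst : lam ⟨0, Nat.lt_of_lt_of_le Nat.zero_lt_one hm.le⟩ = n) :
    Nonempty (shiftedDiagram hm hmn lam).off ↔ 2 < lam ⟨1, hm⟩ := by
  constructor
  · rintro ⟨⟨t, ht⟩⟩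
    obtain ⟨-, h0, h1, h2, h3⟩ := Finset.mem_filter.1 ht
    have h4 : lam ⟨t.1, h2⟩ ≤ lam ⟨1, hm⟩ := hlam (Nat.succ_le_of_lt h0)
    have h5 : (t.1 : ℕ) < t.2 := h1
    omega
  · intro h
    have h2 : lam ⟨1, hm⟩ ≤ lam ⟨0, by omega⟩ := hlam (Nat.zero_le 1)
    exact ⟨⟨(⟨1, by omega⟩, ⟨2, by omega⟩), Finset.mem_filter.2
      ⟨Finset.mem_univ _, Nat.zero_lt_one, by simp [Fin.lt_def], hm, h⟩⟩⟩

end StronglyStable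

/-! ### Regularity, projective dimension and linearity -/

theorem mainTheorem5 {K : Type*} [Field K] {m n : ℕ} (hm : 1 < m) (hmn : m ≤ n)
    (lam : Fin m → ℕ) (hlam : Antitone lam)
    (hlast : ∀ i : Fin m, (i : ℕ) < lam i)
    (hfirst : lam ⟨0, Nat.lt_of_lt_of_le Nat.zero_lt_one hm.le⟩ = n) :
    Nonempty (MinimalGradedFreeResolution K n
        (quotientGrading (lcmDual (stronglyStableIdeal K hmn lam)))) ∧
      ((lcmExponent (stronglyStableIdeal K hmn lam)).degree = n + m) ∧
      ∀ F : MinimalGradedFreeResolution K n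
          (quotientGrading (lcmDual (stronglyStableIdeal K hmn lam))),
        F.IsRegularity ((n : ℤ) + (m : ℤ) - 3) ∧
        (2 < lam ⟨1, hm⟩ → F.IsProjectiveDimension 3) ∧
        (lam ⟨1, hm⟩ = 2 → F.IsProjectiveDimension 2) ∧
        F.IsLinear (n + m - 2) := by
  have hD := degree_doubledExponent hmn
  have ha : ∀ g, (shiftedDiagram hm hmn lam).expo g ≤ doubledExponent m n := fun g =>
    le_doubledExponent hmn
      (range_expo_shiftedDiagram hm hmn lam hlast hfirst ▸ Set.mem_range_self g)
  have hdeg : 2 < (doubledExponent m n).degree := by omega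
  have hoff := nonempty_off_iff hm hmn lam hlam hfirst
  rw [lcmDual_stronglyStableIdeal hm hmn lam hlast hfirst,
    lcmExponent_stronglyStableIdeal hm hmn lam hlast hfirst]
  refine ⟨⟨(shiftedDiagram hm hmn lam).resolution K ha hdeg⟩, hD, fun F => ?_⟩
  have key := fun i j => (shiftedDiagram hm hmn lam).betti_ne_zero_iff ha hdeg F i j
  rw [hD] at key
  have hlin : F.IsLinear (n + m - 2) := by
    intro i j hij
    obtain ⟨b, rfl⟩ := (key (i + 1) j).1 hij
    rfl
  have hbound : ∀ i j, F.betti i j ≠ 0 → i ≤ 3 := by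
    intro i j hij
    obtain ⟨b, -⟩ := (key i j).1 hij
    by_contra! hi
    obtain ⟨k, rfl⟩ := Nat.exists_eq_add_of_le' hi
    exact Empty.elim b
  -- The regularity is attained in homological degree 1, by the dual generator of x_1².
  refine ⟨⟨⟨1, n + m - 2, (key _ _).2 ⟨.inl ⟨0, by omega⟩, rfl⟩, by omega⟩, ?_⟩,
    fun h => ⟨?_, ?_⟩, fun h => ⟨?_, ?_⟩, hlin⟩
  · rintro s ⟨i, j, hij, rfl⟩
    rcases i with _ | i
    · obtain ⟨b, rfl⟩ := (key 0 j).1 hij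
      simp only [ShiftedDiagram.degree]
      omega
    · have := hlin i j hij
      omega
  · obtain ⟨t⟩ := hoff.2 h
    exact ⟨_, (key 3 _).2 ⟨t, rfl⟩⟩
  · rintro i ⟨j, hij⟩
    exact hbound i j hij
  -- Since n ≥ 2, the row syzygy between x_1 x_2 and x_1² always exists.
  · exact ⟨_, (key 2 _).2 ⟨.inl ⟨⟨1, by omega⟩, Nat.zero_lt_one⟩, rfl⟩⟩
  · rintro i ⟨j, hij⟩
    have h3 := hbound i j hij
    by_contra! hi
    obtain rfl : i = 3 := by omega
    obtain ⟨t, -⟩ := (key 3 j).1 hij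
    have := hoff.1 ⟨t⟩
    omega
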